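/- **Theorem 3.10 (Global error).** Let $\mathsf H_1,\mathsf H_0$ be complex Hilbert spaces with $\mathsf H_1$ continuously embedded in $\mathsf H_0$. Let $A$ be a self-adjoint operator in $\mathsf H_1$, with unitary group $\Phi^A(t)=e^{-itA}$, that has a self-adjoint extension $A:D\to\mathsf H_0$ with $\mathsf H_1\subseteq D\subseteq\mathsf H_0$. Let $B:\mathsf H_1\to\mathsf H_1$ be locally Lipschitz, and assume that there is a map $B':\mathsf H_1\to\mathcal B(\mathsf H_0)$ (bounded real-linear operators) such that for all $R,\varepsilon>0$ there are $C,\delta>0$ with $$\|B'(u)\|_{\mathcal B(\mathsf H_0)}\le C,\qquad \|B(u+w)-B(u)-B'(u)w\|_{\mathsf H_0}\le\varepsilon\|w\|_{\mathsf H_0}$$ for all $u,w\in\mathsf H_1$ with $\|u\|_{\mathsf H_1}\le R$ and $\|w\|_{\mathsf H_1}<\delta$. For $u_0\in\mathsf H_1$ let $\Phi(t)u_0=u(t)$, $0\le t<T^*(u_0)$, be the maximal solution, continuous with values in $\mathsf H_1$, of $$u(t)=\Phi^A(t)u_0-i\int_0^t\Phi^A(t-s)B(u(s))\,ds .$$ Let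 $0<T<T^*(u_0)$, and let $\alpha,\beta:\mathbb R\to\mathbb R$ be locally integrable, bounded, $T$-periodic functions with mean value $\frac1T\int_0^T\alpha=\frac1T\int_0^T\beta=1$. For $n\ge1$ put $h_n=T/n$, $\alpha_n(t)=\alpha(nt)$, $\beta_n(t)=\beta(nt)$, and let $\Phi_n(t)u_0=u_n(t)$ be the solution, continuous with values in $\mathsf H_1$, of $$u_n(t)=\Phi^A\Big(\int_0^t\alpha_n\Big)u_0-i\int_0^t\beta_n(s)\,\Phi^A\Big(\int_s^t\alpha_n\Big)B(u_n(s))\,ds .$$ Then there are a constant $C>0$ and $n_0\in\mathbb N$ such that for all $n\ge n_0$ the solution $\Phi_n(t)u_0$ is defined for $t\in[0,T]$ and $$\max_{0\le k\le n}\|\Phi(kh_n)u_0-\Phi_n(kh_n)u_0\|_{\mathsf H_0}\le C\,h_n .$$ -/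

import Mathlib

open MeasureTheory Set

namespace AbstractSplitting

section Group

variable {H : Type*} [NormedAddCommGroup H] [InnerProductSpace ℂ H]

/-- `U` is a strongly continuous one-parameter group of unitary operators on `H` whose
infinitesimal generator is exactly `-iA` (equality of the domains included). -/
structure IsUnitaryGroupOf (A : H →ₗ.[ℂ] H) (U : ℝ → H ≃ₗᵢ[ℂ] H) : Prop where
  map_zero : ∀ x : H, U 0 x = x
  map_add : ∀ (s t : ℝ) (x : H), U (s + t) x = U s (U t x)
  continuous : ∀ x : H, Continuous fun t : ℝ => U t x
  generator : ∀ x y : H, HasDerivAt (fun t : ℝ => U t x) y 0 ↔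
    ∃ hx : x ∈ A.domain, y = -(Complex.I • A ⟨x, hx⟩)

open Classical in
/-- The unitary group `Φ^A` generated by `-iA`. By Stone's theorem it exists, and it is unique,
whenever `A` is self-adjoint; for operators that generate no unitary group the value is
the trivial group. -/
noncomputable def unitaryGroup (A : H →ₗ.[ℂ] H) : ℝ → H ≃ₗᵢ[ℂ] H :=
  if h : ∃ U : ℝ → H ≃ₗᵢ[ℂ] H, IsUnitaryGroupOf A U then h.choose
  else fun _ => LinearIsometryEquiv.refl ℂ H

/-- The propagator `Φ^{A,a}(t₁,t₀) = Φ^A(∫_{t₀}^{t₁} a)` of the linear equation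
`u_t = -i a(t) A u`. -/
noncomputable def propagator (A : H →ₗ.[ℂ] H) (a : ℝ → ℝ) (t₁ t₀ : ℝ) : H ≃ₗᵢ[ℂ] H :=
  unitaryGroup A (∫ s in t₀..t₁, a s)

/-- `u` is a continuous solution on `[0,T]` of Duhamel's equation for
`u_t + iAu + iB(u) = 0`, `u(0) = u₀`. -/
def IsMildSolution (A : H →ₗ.[ℂ] H) (B : H → H) (u₀ : H) (T : ℝ) (u : ℝ → H) : Prop :=
  ContinuousOn u (Icc 0 T) ∧
    ∀ t ∈ Icc (0 : ℝ) T, u t = unitaryGroup A t u₀ -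
      Complex.I • ∫ s in (0 : ℝ)..t, unitaryGroup A (t - s) (B (u s))

/-- `u` is a continuous solution on `[0,T]` of the generalized Duhamel equation for
the non-autonomous problem `u_t + i(a(t)A + b(t)B)u = 0`, `u(0) = u₀`. -/
def IsSplitSolution (A : H →ₗ.[ℂ] H) (B : H → H) (a b : ℝ → ℝ) (u₀ : H) (T : ℝ)
    (u : ℝ → H) : Prop :=
  ContinuousOn u (Icc 0 T) ∧
    ∀ t ∈ Icc (0 : ℝ) T, u t = propagator A a t 0 u₀ -
      Complex.I • ∫ s in (0 : ℝ)..t, b s • propagator A a t s (B (u s))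

/-- The maximal existence time `T*(u₀) ∈ [0,∞]`: the supremum of all `T` such that the
exact problem has a solution on `[0,T]`. -/
noncomputable def maximalTime (A : H →ₗ.[ℂ] H) (B : H → H) (u₀ : H) : ENNReal :=
  sSup {τ | ∃ T : ℝ, 0 ≤ T ∧ τ = ENNReal.ofReal T ∧ ∃ u : ℝ → H, IsMildSolution A B u₀ T u}

open Classical in
/-- The exact flow `Φ(t)u₀ = u(t)`, where `u` is the solution on `[0,t]` of the exact problem
(and the value `0` where there is no solution up to time `t`). -/
noncomputable def exactFlow (A : H →ₗ.[ℂ] H) (B : H → H) (t : ℝ) (u₀ : H) : H :=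
  if h : ∃ u : ℝ → H, IsMildSolution A B u₀ t u then h.choose t else 0

open Classical in
/-- The flow from time `0` to time `t` of the non-autonomous problem with coefficients `a`, `b`
(and the value `0` where there is no solution up to time `t`). -/
noncomputable def splitFlow (A : H →ₗ.[ℂ] H) (B : H → H) (a b : ℝ → ℝ) (t : ℝ) (u₀ : H) : H :=
  if h : ∃ u : ℝ → H, IsSplitSolution A B a b u₀ t u then h.choose t else 0

end Group

/-- The admissible coefficients of an abstract time-splitting method on `[0,T]`: real, locally
integrable, (essentially) bounded, `T`-periodic, with mean value `1` over a period. -/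
structure IsSplittingCoefficient (T : ℝ) (α : ℝ → ℝ) : Prop where
  locallyIntegrable : LocallyIntegrable α volume
  bounded : ∃ M : ℝ, ∀ᵐ t ∂(volume : Measure ℝ), |α t| ≤ M
  periodic : Function.Periodic α T
  mean : (∫ t in (0 : ℝ)..T, α t) / T = 1

/-- The condition on the nonlinearity `B` in terms of `B' : H₁ → 𝓑(H₀)`, uniform on bounded
subsets of `H₁`; `J` is the embedding of `H₁` in `H₀`. The operators `B'(u)` are bounded and
real-linear, as for `B(u) = |u|²u`; complex-linear ones are a special case. -/
def HasUniformDerivative {H₁ H₀ : Type*} [NormedAddCommGroup H₁] [InnerProductSpace ℂ H₁]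
    [NormedAddCommGroup H₀] [InnerProductSpace ℂ H₀] (J : H₁ →L[ℂ] H₀) (B : H₁ → H₁)
    (B' : H₁ → H₀ →L[ℝ] H₀) : Prop :=
  ∀ R > (0 : ℝ), ∀ ε > (0 : ℝ), ∃ C > (0 : ℝ), ∃ δ > (0 : ℝ), ∀ u w : H₁,
    ‖u‖ ≤ R → ‖w‖ < δ →
      ‖B' u‖ ≤ C ∧ ‖J (B (u + w)) - J (B u) - B' u (J w)‖ ≤ ε * ‖J w‖

end AbstractSplitting

/-! Write `U` for the group of `A` and `φ(t) = ∫₀ᵗ a`. In the interaction picture, `w(t) = U(-φ(t))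
u(t)`, the unbounded operator disappears and the equation becomes `w' = b(t) F(φ(t), w)` with `F(τ,
x) = -i U(-τ) B(U(τ) x)`; the exact problem is the case `a = b = 1`, `φ(t) = t`. For coefficients of
period `h` and mean one, `φ(t) - t = O(h)` and `b - 1` averages out, so the exact curve `v` solves
the perturbed integral equation up to a small defect (`norm_integral_smul_sub_integral_le`).

The defect is measured in two norms. In `H₁` the map `(τ, s) ↦ F(τ, v(s))` is only uniformly
continuous on compact sets, so the defect is `o(1)`; this suffices for a contraction argument that
gives a solution on all of `[0,T]` near `v` (`exists_solution_near`). In `H₀` the same map is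
Lipschitz, because `A₀` is bounded from `H₁` to `H₀` and `B` is Lipschitz in the `H₀` norm near
bounded sets of `H₁`; the defect is then `O(h)`, and Grönwall's inequality in `H₀` turns it into the
error bound.

At the times `kh` one has `φ(kh) = kh`, so both solutions are carried back by the same unitary
operator, which preserves the `H₀` norm. Between these times this identity can fail, which is why
the estimate is made on the grid. -/

namespace AbstractSplitting

/-! ### Strongly continuous unitary groups. -/

section Group

variable {H : Type*} [NormedAddCommGroup H] [InnerProductSpace ℂ H]

/-- A strongly continuous one-parameter group of unitary operators, without reference to its
generator. -/
structure IsContinuousGroup (U : ℝ → H ≃ₗᵢ[ℂ] H) : Prop where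
  map_zero : ∀ x : H, U 0 x = x
  map_add : ∀ (s t : ℝ) (x : H), U (s + t) x = U s (U t x)
  continuous : ∀ x : H, Continuous fun t : ℝ => U t x

theorem IsUnitaryGroupOf.isContinuousGroup {A : H →ₗ.[ℂ] H} {U : ℝ → H ≃ₗᵢ[ℂ] H}
    (h : IsUnitaryGroupOf A U) : IsContinuousGroup U :=
  ⟨h.map_zero, h.map_add, h.continuous⟩

theorem isContinuousGroup_refl :
    IsContinuousGroup fun _ : ℝ => LinearIsometryEquiv.refl ℂ H :=
  ⟨fun _ => rfl, fun _ _ _ => rfl, fun _ => continuous_const⟩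

theorem isContinuousGroup_unitaryGroup (A : H →ₗ.[ℂ] H) : IsContinuousGroup (unitaryGroup A) := by
  unfold unitaryGroup
  split_ifs with h
  · exact h.choose_spec.isContinuousGroup
  · exact isContinuousGroup_refl

namespace IsContinuousGroup

variable {U : ℝ → H ≃ₗᵢ[ℂ] H}

theorem apply_neg_apply (hU : IsContinuousGroup U) (t : ℝ) (x : H) : U t (U (-t) x) = x := by
  rw [← hU.map_add, add_neg_cancel, hU.map_zero]

theorem neg_apply_apply (hU : IsContinuousGroup U) (t : ℝ) (x : H) : U (-t) (U t x) = x := by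
  rw [← hU.map_add, neg_add_cancel, hU.map_zero]

/-- Strong continuity becomes joint continuity because the operators are isometries, hence
equicontinuous in the space variable. -/
theorem continuous_uncurry (hU : IsContinuousGroup U) :
    Continuous fun p : ℝ × H => U p.1 p.2 := by
  rw [continuous_iff_continuousAt]
  rintro ⟨t₀, x₀⟩
  rw [ContinuousAt, tendsto_iff_norm_sub_tendsto_zero]
  have h₁ : Filter.Tendsto (fun p : ℝ × H => ‖p.2 - x₀‖ + ‖U p.1 x₀ - U t₀ x₀‖)
      (nhds (t₀, x₀)) (nhds 0) := by
    have : Continuous fun p : ℝ × H => ‖p.2 - x₀‖ + ‖U p.1 x₀ - U t₀ x₀‖ :=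
      (continuous_snd.sub continuous_const).norm.add
        (((hU.continuous x₀).comp continuous_fst).sub continuous_const).norm
    simpa using this.tendsto (t₀, x₀)
  refine squeeze_zero (fun _ => norm_nonneg _) (fun p => ?_) h₁
  calc ‖U p.1 p.2 - U t₀ x₀‖ = ‖U p.1 (p.2 - x₀) + (U p.1 x₀ - U t₀ x₀)‖ := by
        rw [map_sub]; abel_nf
    _ ≤ ‖U p.1 (p.2 - x₀)‖ + ‖U p.1 x₀ - U t₀ x₀‖ := norm_add_le _ _
    _ = ‖p.2 - x₀‖ + ‖U p.1 x₀ - U t₀ x₀‖ := by rw [LinearIsometryEquiv.norm_map]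

end IsContinuousGroup

namespace IsUnitaryGroupOf

variable {A : H →ₗ.[ℂ] H} {U : ℝ → H ≃ₗᵢ[ℂ] H}

/-- The generator is known at time `0` only. Since `U t` commutes with `U s`, the orbit of `U t x`
is differentiable at `0`, which puts `U t x` in the domain; a translation in time moves the
derivative to `t`. -/
theorem exists_hasDerivAt (h : IsUnitaryGroupOf A U) (x : A.domain) (t : ℝ) :
    ∃ hx : U t x ∈ A.domain,
      HasDerivAt (fun s : ℝ => U s x) (-(Complex.I • A ⟨U t x, hx⟩)) t := by
  have h₀ : HasDerivAt (fun s : ℝ => U s x) (-(Complex.I • A x)) 0 :=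
    (h.generator _ _).2 ⟨x.2, rfl⟩
  have h₁ : HasDerivAt (fun s : ℝ => U t (U s x)) (U t (-(Complex.I • A x))) 0 :=
    ((U t).toContinuousLinearEquiv.toContinuousLinearMap.restrictScalars ℝ).hasFDerivAt.comp_hasDerivAt
      0 h₀
  have h₂ : HasDerivAt (fun s : ℝ => U s (U t x)) (U t (-(Complex.I • A x))) 0 := by
    convert h₁ using 2 with s
    rw [← h.map_add, ← h.map_add, add_comm]
  obtain ⟨hx, hy⟩ := (h.generator _ _).1 h₂
  refine ⟨hx, ?_⟩
  rw [← hy]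
  have h₃ : HasDerivAt (fun s : ℝ => U (s - t) (U t x)) (U t (-(Complex.I • A x))) t :=
    HasDerivAt.comp_sub_const t t (by rw [sub_self]; exact h₂)
  convert h₃ using 2 with s
  rw [← h.map_add, sub_add_cancel]

end IsUnitaryGroupOf

end Group

/-! ### The group of `A` in the norm of the larger space. -/

section Embedding

variable {H₁ H₀ : Type*} [NormedAddCommGroup H₁] [InnerProductSpace ℂ H₁]
  [NormedAddCommGroup H₀] [InnerProductSpace ℂ H₀]

/-- The group `U` on `H₁` is isometric and uniformly Lipschitz in time when it is measured in the
weaker norm of `H₀`. -/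
structure IsRegularEmbedding (J : H₁ →L[ℂ] H₀) (U : ℝ → H₁ ≃ₗᵢ[ℂ] H₁) (K : ℝ) : Prop where
  nonneg : 0 ≤ K
  norm_map : ∀ (t : ℝ) (x : H₁), ‖J (U t x)‖ = ‖J x‖
  lipschitz : ∀ (s t : ℝ) (x : H₁), ‖J (U t x) - J (U s x)‖ ≤ K * |t - s| * ‖x‖

/-- A self-adjoint operator that is defined on an embedded complete space is bounded there,
by the closed graph theorem. -/
theorem exists_bound_extension [CompleteSpace H₁] [CompleteSpace H₀] (J : H₁ →L[ℂ] H₀)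
    (A₀ : H₀ →ₗ.[ℂ] H₀) (hA₀ : IsSelfAdjoint A₀) (hdom : ∀ x : H₁, J x ∈ A₀.domain) :
    ∃ K : ℝ, 0 ≤ K ∧ ∀ x : H₁, ‖A₀ ⟨J x, hdom x⟩‖ ≤ K * ‖x‖ := by
  let L : H₁ →ₗ[ℂ] H₀ := A₀.toFun ∘ₗ J.toLinearMap.codRestrict A₀.domain hdom
  have hL : ∀ x, L x = A₀ ⟨J x, hdom x⟩ := fun _ => rfl
  have hc : Continuous L := by
    refine L.continuous_of_seq_closed_graph fun u x y hu hy => ?_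
    have hcl : IsClosed (A₀.graph : Set (H₀ × H₀)) := hA₀.isClosed
    have hmem : (J x, y) ∈ (A₀.graph : Set (H₀ × H₀)) := by
      refine hcl.mem_of_tendsto (((J.continuous.tendsto x).comp hu).prodMk_nhds hy)
        (Filter.Eventually.of_forall fun n => ?_)
      exact A₀.mem_graph ⟨J (u n), hdom (u n)⟩
    obtain ⟨z, hz₁, hz₂⟩ := (A₀.mem_graph_iff).1 hmem
    obtain rfl : z = ⟨J x, hdom x⟩ := Subtype.ext hz₁
    exact hz₂.symm
  let L' : H₁ →L[ℂ] H₀ := ⟨L, hc⟩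
  exact ⟨‖L'‖, norm_nonneg _, fun x => L'.le_opNorm x⟩

theorem inner_apply_self_im (A₀ : H₀ →ₗ.[ℂ] H₀) [CompleteSpace H₀] (hA₀ : IsSelfAdjoint A₀)
    (x : A₀.domain) : (inner ℂ (x : H₀) (A₀ x)).im = 0 := by
  have h := LinearPMap.adjoint_isFormalAdjoint hA₀.dense_domain
  rw [LinearPMap.isSelfAdjoint_def.1 hA₀] at h
  have h₁ : inner ℂ (A₀ x) (x : H₀) = inner ℂ (x : H₀) (A₀ x) := h x x
  rw [← inner_conj_symm] at h₁
  exact Complex.conj_eq_iff_im.1 h₁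

/-- For `x` in the domain of `A`, the curve `J (U t x)` solves the linear equation of `A₀`: symmetry
of `A₀` conserves its norm, and its speed is at most `K * ‖x‖` by the closed graph bound. Both
conclusions are closed conditions on `x`, so density of the domain gives them on all of `H₁`. -/
theorem IsUnitaryGroupOf.isRegularEmbedding [CompleteSpace H₁] [CompleteSpace H₀]
    {A : H₁ →ₗ.[ℂ] H₁} {U : ℝ → H₁ ≃ₗᵢ[ℂ] H₁} (h : IsUnitaryGroupOf A U)
    (hA : IsSelfAdjoint A) (J : H₁ →L[ℂ] H₀)
    (A₀ : H₀ →ₗ.[ℂ] H₀) (hA₀ : IsSelfAdjoint A₀) (hdom : ∀ x : H₁, J x ∈ A₀.domain)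
    (hext : ∀ x : A.domain, A₀ ⟨J (x : H₁), hdom x⟩ = J (A x)) :
    ∃ K : ℝ, IsRegularEmbedding J U K := by
  obtain ⟨K, hK, hbound⟩ := exists_bound_extension J A₀ hA₀ hdom
  have hder : ∀ (x : A.domain) (t : ℝ), HasDerivAt (fun s : ℝ => J (U s x))
      (-(Complex.I • A₀ ⟨J (U t x), hdom _⟩)) t := by
    intro x t
    obtain ⟨hx, hd⟩ := h.exists_hasDerivAt x t
    have := (J.restrictScalars ℝ).hasFDerivAt.comp_hasDerivAt t hd
    rw [hext ⟨U t x, hx⟩]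
    simpa [Function.comp_def] using this
  refine ⟨K, hK, fun t x => ?_, fun s t x => ?_⟩
  · have hcl : IsClosed {x : H₁ | ‖J (U t x)‖ = ‖J x‖} :=
      isClosed_eq ((J.continuous.comp (U t).continuous).norm) J.continuous.norm
    refine hcl.closure_subset_iff.2 ?_ (hA.dense_domain x)
    intro y hy
    have hsq : ∀ s : ℝ, HasDerivAt (fun r : ℝ => ‖J (U r y)‖ ^ 2) 0 s := by
      intro s
      let : InnerProductSpace ℝ H₀ := InnerProductSpace.rclikeToReal ℂ H₀
      have := (hder ⟨y, hy⟩ s).norm_sq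
      convert this using 1
      rw [real_inner_eq_re_inner ℂ]
      simp [inner_neg_right, inner_smul_right, inner_apply_self_im A₀ hA₀ ⟨J (U s y), hdom _⟩]
    have hconst := is_const_of_deriv_eq_zero (fun s => (hsq s).differentiableAt)
      (fun s => (hsq s).deriv) t 0
    simp only [h.map_zero] at hconst
    exact (sq_eq_sq₀ (norm_nonneg _) (norm_nonneg _)).1 hconst
  · have hcl : IsClosed {x : H₁ | ‖J (U t x) - J (U s x)‖ ≤ K * |t - s| * ‖x‖} :=
      isClosed_le (((J.continuous.comp (U t).continuous).sub
        (J.continuous.comp (U s).continuous)).norm) (continuous_const.mul continuous_norm)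
    refine hcl.closure_subset_iff.2 ?_ (hA.dense_domain x)
    intro y hy
    have := convex_univ.norm_image_sub_le_of_norm_hasDerivWithin_le
      (f := fun r : ℝ => J (U r y)) (C := K * ‖y‖)
      (fun r _ => (hder ⟨y, hy⟩ r).hasDerivWithinAt) (fun r _ => ?_) (mem_univ s) (mem_univ t)
    · rw [Real.norm_eq_abs] at this
      exact this.trans_eq (by ring)
    · rw [norm_neg, norm_smul, Complex.norm_I, one_mul, ← (U r).norm_map y]
      exact hbound _

/-- By Stone's theorem the second case of the definition of `unitaryGroup A` does not occur for a
self-adjoint `A`; the estimates do not need that fact, as they hold for the trivial group too. -/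
theorem exists_isRegularEmbedding_unitaryGroup [CompleteSpace H₁] [CompleteSpace H₀]
    (A : H₁ →ₗ.[ℂ] H₁) (hA : IsSelfAdjoint A) (J : H₁ →L[ℂ] H₀)
    (A₀ : H₀ →ₗ.[ℂ] H₀) (hA₀ : IsSelfAdjoint A₀) (hdom : ∀ x : H₁, J x ∈ A₀.domain)
    (hext : ∀ x : A.domain, A₀ ⟨J (x : H₁), hdom x⟩ = J (A x)) :
    ∃ K : ℝ, IsRegularEmbedding J (unitaryGroup A) K := by
  unfold unitaryGroup
  split_ifs with h
  · exact h.choose_spec.isRegularEmbedding hA J A₀ hA₀ hdom hext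
  · exact ⟨0, le_rfl, fun _ _ => rfl, fun _ _ _ => by simp⟩

end Embedding

/-! ### Grönwall, averaging, and existence near an approximate solution. -/

section Analysis

/-- Grönwall's inequality in integral form. -/
theorem le_mul_exp_of_le_add_integral {f : ℝ → ℝ} {a K T : ℝ} (hK : 0 ≤ K) (hf : Continuous f)
    (h : ∀ t ∈ Icc 0 T, f t ≤ a + K * ∫ s in (0 : ℝ)..t, f s) :
    ∀ t ∈ Icc 0 T, f t ≤ a * Real.exp (K * t) := by
  intro t ht
  -- The differential form of Grönwall's inequality is applied to the right-hand side, which is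
  -- differentiable although `f` need not be.
  have hd : ∀ x : ℝ, HasDerivAt (fun t => a + K * ∫ s in (0 : ℝ)..t, f s) (K * f x) x := fun x =>
    ((intervalIntegral.integral_hasDerivAt_right (hf.intervalIntegrable _ _)
      hf.aestronglyMeasurable.stronglyMeasurableAtFilter hf.continuousAt).const_mul K).const_add a
  have := le_gronwallBound_of_liminf_deriv_right_le (f := fun t => a + K * ∫ s in (0 : ℝ)..t, f s)
    (f' := fun x => K * f x) (δ := a) (K := K) (ε := 0) (a := 0) (b := T)
    (fun x _ => (hd x).continuousAt.continuousWithinAt)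
    (fun x _ r hr => (hd x).hasDerivWithinAt.liminf_right_slope_le hr)
    (by simp) (fun x hx => by
      have := mul_le_mul_of_nonneg_left (h x (Ico_subset_Icc_self hx)) hK
      simpa using this) t ht
  rw [gronwallBound_ε0, sub_zero] at this
  exact (h t ht).trans this

variable {E : Type*} [NormedAddCommGroup E] [NormedSpace ℝ E]

theorem norm_integral_smul_le {b : ℝ → ℝ} {M g s t : ℝ} {G : ℝ → E} (hst : s ≤ t)
    (hM : ∀ᵐ x ∂(volume : Measure ℝ), |b x| ≤ M) (hG : ∀ x ∈ Icc s t, ‖G x‖ ≤ g) :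
    ‖∫ x in s..t, b x • G x‖ ≤ M * g * (t - s) := by
  have := intervalIntegral.norm_integral_le_of_norm_le_const_ae (a := s) (b := t) (C := M * g)
    (f := fun x => b x • G x) ?_
  · rwa [abs_of_nonneg (sub_nonneg.2 hst)] at this
  · filter_upwards [hM] with x hx hxm
    rw [uIoc_of_le hst] at hxm
    rw [norm_smul, Real.norm_eq_abs]
    exact mul_le_mul hx (hG x (Ioc_subset_Icc_self hxm)) (norm_nonneg _)
      ((abs_nonneg _).trans hx)

/-- Averaging: a bounded periodic function of mean zero with small period `h` has a small integral
against a function `G` that varies little over one period. -/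
theorem norm_integral_periodic_smul_le [CompleteSpace E] {γ : ℝ → ℝ} {h m ω g T : ℝ} {G : ℝ → E}
    (hh : 0 < h) (hγ : ∀ s t, IntervalIntegrable γ volume s t) (hper : Function.Periodic γ h)
    (hmean : ∫ t in (0 : ℝ)..h, γ t = 0) (hm : ∀ᵐ t ∂(volume : Measure ℝ), |γ t| ≤ m)
    (hG : Continuous G) (hω : 0 ≤ ω) (hg : ∀ s ∈ Icc 0 T, ‖G s‖ ≤ g)
    (hosc : ∀ s ∈ Icc 0 T, ∀ t ∈ Icc 0 T, |s - t| ≤ h → ‖G s - G t‖ ≤ ω) :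
    ∀ t ∈ Icc 0 T, ‖∫ s in (0 : ℝ)..t, γ s • G s‖ ≤ m * (ω * t + g * h) := by
  have hm₀ : 0 ≤ m := by
    obtain ⟨x, hx⟩ := hm.exists
    exact (abs_nonneg _).trans hx
  have hint : ∀ s t, IntervalIntegrable (fun x => γ x • G x) volume s t := fun s t =>
    (hγ s t).smul_continuousOn hG.continuousOn
  have hstep : ∀ k : ℕ, (k : ℝ) * h ≤ T →
      ‖∫ s in (0 : ℝ)..(k * h), γ s • G s‖ ≤ m * ω * (k * h) := by
    intro k
    induction k with
    | zero => simp
    | succ k ih =>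
      intro hk
      push_cast at hk ⊢
      have hk₀ : 0 ≤ (k : ℝ) * h := by positivity
      have hk₁ : (k + 1 : ℝ) * h = k * h + h := by ring
      rw [hk₁] at hk ⊢
      rw [← intervalIntegral.integral_add_adjacent_intervals (hint 0 (k * h)) (hint _ _)]
      have hmean' : ∫ s in (k * h : ℝ)..(k * h + h), γ s = 0 := by
        rw [hper.intervalIntegral_add_eq (k * h) 0, zero_add, hmean]
      -- Over a full period `γ` integrates to zero, so the value of `G` at the left endpoint can be
      -- subtracted for free and only the oscillation `ω` remains.
      have heq : ∫ s in (k * h : ℝ)..(k * h + h), γ s • G s =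
          ∫ s in (k * h : ℝ)..(k * h + h), γ s • (G s - G (k * h)) := by
        simp_rw [smul_sub]
        rw [intervalIntegral.integral_sub (hint _ _)
            ((hγ _ _).smul_continuousOn continuousOn_const),
          intervalIntegral.integral_smul_const, hmean', zero_smul, sub_zero]
      have hb := norm_integral_smul_le (G := fun s => G s - G (k * h)) (g := ω)
        (by linarith : (k * h : ℝ) ≤ k * h + h) hm (fun s hs => hosc s
          ⟨hk₀.trans hs.1, hs.2.trans hk⟩ _ ⟨hk₀, by linarith⟩
          (by rw [abs_of_nonneg (sub_nonneg.2 hs.1)]; linarith [hs.2]))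
      rw [← heq] at hb
      refine (norm_add_le _ _).trans ?_
      linarith [ih (by linarith)]
  intro t ht
  -- The `k` full periods contribute the oscillation term; the incomplete last one has length at
  -- most `h` and contributes `m * g * h`.
  set k := ⌊t / h⌋₊ with hkdef
  have hk₁ : (k : ℝ) * h ≤ t := by
    rw [← le_div_iff₀ hh]
    exact Nat.floor_le (div_nonneg ht.1 hh.le)
  have hk₂ : t < k * h + h := by
    have := Nat.lt_floor_add_one (t / h)
    rw [div_lt_iff₀ hh] at this
    linarith
  have hk₀ : 0 ≤ (k : ℝ) * h := by positivity
  have hg₀ : 0 ≤ g := (norm_nonneg _).trans (hg t ht)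
  rw [← intervalIntegral.integral_add_adjacent_intervals (hint 0 (k * h)) (hint _ _)]
  have hb := norm_integral_smul_le hk₁ hm (G := G) (g := g)
    (fun s hs => hg s ⟨hk₀.trans hs.1, hs.2.trans ht.2⟩)
  calc _ ≤ m * ω * (k * h) + m * g * (t - k * h) :=
        (norm_add_le _ _).trans (add_le_add (hstep k (hk₁.trans ht.2)) hb)
    _ ≤ m * ω * t + m * g * h := by
        gcongr
        linarith
    _ = m * (ω * t + g * h) := by ring

/-- A locally Lipschitz function is Lipschitz, with one constant, on the balls of some fixed radius
around the points of a compact set. -/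
theorem exists_uniform_lipschitz_of_isCompact {E F : Type*} [NormedAddCommGroup E]
    [NormedAddCommGroup F] {B : E → F}
    (hB : LocallyLipschitz B) {S : Set E} (hS : IsCompact S) :
    ∃ ε > (0 : ℝ), ∃ L : ℝ, 0 ≤ L ∧ ∀ x ∈ S, ∀ y ∈ Metric.closedBall x ε,
      ∀ z ∈ Metric.closedBall x ε, ‖B y - B z‖ ≤ L * ‖y - z‖ := by
  refine hS.induction_on ⟨1, one_pos, 0, le_rfl, by simp⟩ ?_ ?_ ?_
  · rintro s t hst ⟨ε, hε, L, hL, h⟩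
    exact ⟨ε, hε, L, hL, fun x hx => h x (hst hx)⟩
  · rintro s t ⟨ε, hε, L, hL, h⟩ ⟨ε', hε', L', hL', h'⟩
    refine ⟨min ε ε', lt_min hε hε', max L L', hL.trans (le_max_left _ _), ?_⟩
    rintro x (hx | hx) y hy z hz
    · exact (h x hx y (Metric.closedBall_subset_closedBall (min_le_left _ _) hy) z
        (Metric.closedBall_subset_closedBall (min_le_left _ _) hz)).trans
        (mul_le_mul_of_nonneg_right (le_max_left _ _) (norm_nonneg _))
    · exact (h' x hx y (Metric.closedBall_subset_closedBall (min_le_right _ _) hy) z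
        (Metric.closedBall_subset_closedBall (min_le_right _ _) hz)).trans
        (mul_le_mul_of_nonneg_right (le_max_right _ _) (norm_nonneg _))
  · intro x _
    obtain ⟨L, t, ht, hL⟩ := hB x
    obtain ⟨ε, hε, hball⟩ := Metric.mem_nhds_iff.1 ht
    -- A center within `ε / 2` of `x` with radius `ε / 4` stays inside the ball of radius `ε` around
    -- `x`.
    refine ⟨Metric.ball x (ε / 2), mem_nhdsWithin_of_mem_nhds (Metric.ball_mem_nhds x (half_pos hε)),
      ε / 4, by positivity, L, L.2, fun x' hx' y hy z hz => ?_⟩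
    have hsub : Metric.closedBall x' (ε / 4) ⊆ t := by
      refine Subset.trans ?_ hball
      refine Metric.closedBall_subset_ball' ?_
      have := Metric.mem_ball.1 hx'
      linarith
    exact hL.norm_sub_le (hsub hy) (hsub hz)

theorem exp_neg_mul_integral_exp_le {l t : ℝ} (hl : 0 < l) :
    Real.exp (-(l * t)) * ∫ s in (0 : ℝ)..t, Real.exp (l * s) ≤ 1 / l := by
  have h : ∫ s in (0 : ℝ)..t, Real.exp (l * s) = (Real.exp (l * t) - 1) / l := by
    rw [intervalIntegral.integral_comp_mul_left _ hl.ne']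
    simp [div_eq_inv_mul]
  rw [h, mul_div_assoc', mul_sub, ← Real.exp_add, neg_add_cancel, Real.exp_zero, mul_one]
  gcongr
  linarith [Real.exp_pos (-(l * t))]

/-- If `v` solves a Carathéodory integral equation up to a small defect, then there is an exact
solution near `v`. -/
theorem exists_solution_near [CompleteSpace E] {T ε L M η : ℝ} (hT : 0 ≤ T)
    (hL : 0 ≤ L) {b : ℝ → ℝ} (hb : ∀ s t, IntervalIntegrable b volume s t)
    (hM : ∀ᵐ t ∂(volume : Measure ℝ), |b t| ≤ M) {f : ℝ → E → E}
    (hf : Continuous fun p : ℝ × E => f p.1 p.2) {v : ℝ → E} (hv : Continuous v) (x₀ : E)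
    (hlip : ∀ s ∈ Icc 0 T, ∀ x ∈ Metric.closedBall (v s) ε, ∀ y ∈ Metric.closedBall (v s) ε,
      ‖f s x - f s y‖ ≤ L * ‖x - y‖)
    (hdefect : ∀ t ∈ Icc 0 T, ‖x₀ + (∫ s in (0 : ℝ)..t, b s • f s (v s)) - v t‖ ≤ η)
    (hη : 2 * η * Real.exp ((2 * M * L + 1) * T) ≤ ε) :
    ∃ w : ℝ → E, Continuous w ∧
      (∀ t ∈ Icc 0 T, w t = x₀ + ∫ s in (0 : ℝ)..t, b s • f s (w s)) ∧
      ∀ t ∈ Icc 0 T, ‖w t - v t‖ ≤ 2 * η * Real.exp ((2 * M * L + 1) * T) := by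
  have hM₀ : 0 ≤ M := by
    obtain ⟨x, hx⟩ := hM.exists
    exact (abs_nonneg _).trans hx
  have hη₀ : 0 ≤ η := (norm_nonneg _).trans (hdefect 0 ⟨le_rfl, hT⟩)
  -- The rate of an exponentially weighted sup norm, chosen so that the contraction factor `M * L /
  -- l` is at most `1 / 2` whatever the length of the interval. The summand `1` keeps `l` positive.
  set l : ℝ := 2 * M * L + 1 with hl
  have hl₀ : 0 < l := by positivity
  -- The unknown `z` is the deviation from `v` divided by the weight, so that the plain sup norm of
  -- `z` is the weighted norm of the deviation.
  let W : C(Icc (0 : ℝ) T, E) → ℝ → E := fun z s => v s + Real.exp (l * s) • IccExtend hT z s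
  have hW : ∀ z, Continuous (W z) := fun z =>
    hv.add ((Real.continuous_exp.comp (continuous_const.mul continuous_id)).smul
      z.continuous.Icc_extend')
  have hint : ∀ z s t, IntervalIntegrable (fun s => b s • f s (W z s)) volume s t := fun z s t =>
    (hb s t).smul_continuousOn (hf.comp (continuous_id.prodMk (hW z))).continuousOn
  let Ψ : C(Icc (0 : ℝ) T, E) → ℝ → E := fun z t =>
    Real.exp (-(l * t)) • (x₀ + (∫ s in (0 : ℝ)..t, b s • f s (W z s)) - v t)
  have hΨ : ∀ z, Continuous (Ψ z) := fun z =>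
    (Real.continuous_exp.comp (continuous_const.mul continuous_id).neg).smul
      ((continuous_const.add (intervalIntegral.continuous_primitive (hint z) 0)).sub hv)
  let Φ : C(Icc (0 : ℝ) T, E) → C(Icc (0 : ℝ) T, E) := fun z =>
    ⟨fun t => Ψ z t, (hΨ z).comp continuous_subtype_val⟩
  -- With `hη`, this keeps `W z` in the tube around `v` where `f` is Lipschitz. The radius `2 * η`
  -- fits `‖Φ 0‖ ≤ η` and contraction factor `1 / 2`, so the ball is mapped to itself.
  have hz : ∀ z ∈ Metric.closedBall (0 : C(Icc (0 : ℝ) T, E)) (2 * η), ∀ s ∈ Icc 0 T,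
      ‖W z s - v s‖ ≤ 2 * η * Real.exp (l * T) := by
    intro z hz s hs
    have h₁ : ‖IccExtend hT z s‖ ≤ 2 * η :=
      (z.norm_coe_le_norm _).trans (mem_closedBall_zero_iff.1 hz)
    have h₂ : Real.exp (l * s) ≤ Real.exp (l * T) :=
      Real.exp_le_exp.2 (mul_le_mul_of_nonneg_left hs.2 hl₀.le)
    simp only [W, add_sub_cancel_left]
    rw [norm_smul, Real.norm_eq_abs, Real.abs_exp, mul_comm]
    exact mul_le_mul h₁ h₂ (Real.exp_pos _).le (by positivity)
  have hcontr : ∀ z ∈ Metric.closedBall (0 : C(Icc (0 : ℝ) T, E)) (2 * η),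
      ∀ z' ∈ Metric.closedBall (0 : C(Icc (0 : ℝ) T, E)) (2 * η),
      dist (Φ z) (Φ z') ≤ 1 / 2 * dist z z' := by
    intro z hz₁ z' hz₂
    rw [ContinuousMap.dist_le (by positivity)]
    rintro ⟨t, ht⟩
    have hpt : ∀ᵐ s ∂(volume : Measure ℝ), s ∈ Ioc 0 t →
        ‖b s • f s (W z s) - b s • f s (W z' s)‖ ≤ M * L * dist z z' * Real.exp (l * s) := by
      filter_upwards [hM] with s hs hst
      have hsT : s ∈ Icc 0 T := ⟨hst.1.le, hst.2.trans ht.2⟩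
      have h₁ := hlip s hsT (W z s)
        (mem_closedBall_iff_norm.2 ((hz z hz₁ s hsT).trans hη)) (W z' s)
        (mem_closedBall_iff_norm.2 ((hz z' hz₂ s hsT).trans hη))
      have h₂ : ‖W z s - W z' s‖ ≤ Real.exp (l * s) * dist z z' := by
        simp only [W, add_sub_add_left_eq_sub]
        rw [← smul_sub, norm_smul, Real.norm_eq_abs, Real.abs_exp, ← dist_eq_norm]
        exact mul_le_mul_of_nonneg_left (ContinuousMap.dist_apply_le_dist _) (Real.exp_pos _).le
      rw [← smul_sub, norm_smul, Real.norm_eq_abs]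
      calc |b s| * ‖f s (W z s) - f s (W z' s)‖
          ≤ M * (L * (Real.exp (l * s) * dist z z')) :=
            mul_le_mul hs (h₁.trans (mul_le_mul_of_nonneg_left h₂ hL)) (norm_nonneg _) hM₀
        _ = _ := by ring
    have hexp : Continuous fun s : ℝ => M * L * dist z z' * Real.exp (l * s) :=
      continuous_const.mul (Real.continuous_exp.comp (continuous_const.mul continuous_id))
    have hI := intervalIntegral.norm_integral_le_of_norm_le ht.1 hpt (hexp.intervalIntegrable _ _)
    rw [intervalIntegral.integral_sub (hint z _ _) (hint z' _ _),
      intervalIntegral.integral_const_mul] at hI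
    have hE := exp_neg_mul_integral_exp_le (t := t) hl₀
    change dist (Ψ z t) (Ψ z' t) ≤ _
    rw [dist_eq_norm, ← smul_sub, norm_smul, Real.norm_eq_abs, Real.abs_exp,
      sub_sub_sub_cancel_right, add_sub_add_left_eq_sub]
    calc _ ≤ Real.exp (-(l * t)) * (M * L * dist z z' * ∫ s in (0 : ℝ)..t, Real.exp (l * s)) :=
          mul_le_mul_of_nonneg_left hI (Real.exp_pos _).le
      _ = M * L * dist z z' * (Real.exp (-(l * t)) * ∫ s in (0 : ℝ)..t, Real.exp (l * s)) := by
          ring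
      _ ≤ M * L * dist z z' * (1 / l) := mul_le_mul_of_nonneg_left hE (by positivity)
      _ = M * L / l * dist z z' := by ring
      _ ≤ 1 / 2 * dist z z' := by
          refine mul_le_mul_of_nonneg_right ?_ dist_nonneg
          rw [div_le_div_iff₀ hl₀ two_pos]
          linarith
  have hΦ0 : ‖Φ 0‖ ≤ η := by
    rw [ContinuousMap.norm_le _ hη₀]
    rintro ⟨t, ht⟩
    have hW0 : W 0 = v := by
      funext s
      simp [W, IccExtend]
    change ‖Ψ 0 t‖ ≤ η
    simp only [Ψ, hW0]
    rw [norm_smul, Real.norm_eq_abs, Real.abs_exp]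
    refine (mul_le_of_le_one_left (norm_nonneg _) ?_).trans (hdefect t ht)
    rw [Real.exp_le_one_iff]
    have := mul_nonneg hl₀.le ht.1
    linarith
  have h0 : (0 : C(Icc (0 : ℝ) T, E)) ∈ Metric.closedBall (0 : C(Icc (0 : ℝ) T, E)) (2 * η) :=
    Metric.mem_closedBall_self (by positivity)
  have hmaps : MapsTo Φ (Metric.closedBall 0 (2 * η)) (Metric.closedBall 0 (2 * η)) := by
    intro z hz
    have h₁ := hcontr z hz 0 h0
    rw [mem_closedBall_zero_iff] at hz ⊢
    rw [dist_eq_norm, dist_zero_right] at h₁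
    calc ‖Φ z‖ = ‖(Φ z - Φ 0) + Φ 0‖ := by rw [sub_add_cancel]
      _ ≤ 1 / 2 * ‖z‖ + η := (norm_add_le _ _).trans (add_le_add h₁ hΦ0)
      _ ≤ 2 * η := by linarith
  have hcw : ContractingWith (1 / 2) (hmaps.restrict Φ _ _) := by
    refine ⟨by norm_num, LipschitzWith.of_dist_le_mul fun x y => ?_⟩
    have := hcontr x x.2 y y.2
    rw [NNReal.coe_div, NNReal.coe_one, NNReal.coe_ofNat]
    exact this
  obtain ⟨z, hzm, hfix, -⟩ := hcw.exists_fixedPoint' Metric.isClosed_closedBall.isComplete hmaps h0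
    (edist_ne_top _ _)
  refine ⟨W z, hW z, fun t ht => ?_, hz z hzm⟩
  have h₁ : z ⟨t, ht⟩ = Ψ z t := by
    conv_lhs => rw [← hfix.eq]
    rfl
  have h₂ : W z t = v t + Real.exp (l * t) • Ψ z t := by
    rw [← h₁]
    simp only [W]
    rw [IccExtend_of_mem hT _ ht]
  rw [h₂]
  simp only [Ψ]
  rw [smul_smul, ← Real.exp_add, add_neg_cancel, Real.exp_zero, one_smul, add_sub_cancel]

end Analysis

/-! ### The interaction picture and uniqueness of solutions. -/

section Interaction

variable {H : Type*} [NormedAddCommGroup H] [InnerProductSpace ℂ H]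

/-- The right-hand side `-i U(-τ) B(U(τ) x)` of the equation in the interaction picture. -/
noncomputable def interactionField (U : ℝ → H ≃ₗᵢ[ℂ] H) (B : H → H) (τ : ℝ) (x : H) : H :=
  -(Complex.I • U (-τ) (B (U τ x)))

theorem norm_interactionField (U : ℝ → H ≃ₗᵢ[ℂ] H) (B : H → H) (τ : ℝ) (x : H) :
    ‖interactionField U B τ x‖ = ‖B (U τ x)‖ := by
  rw [interactionField, norm_neg, norm_smul, Complex.norm_I, one_mul, LinearIsometryEquiv.norm_map]

theorem norm_interactionField_sub (U : ℝ → H ≃ₗᵢ[ℂ] H) (B : H → H) (τ : ℝ) (x y : H) :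
    ‖interactionField U B τ x - interactionField U B τ y‖ = ‖B (U τ x) - B (U τ y)‖ := by
  rw [interactionField, interactionField, neg_sub_neg, ← smul_sub, ← map_sub, norm_smul,
    Complex.norm_I, one_mul, LinearIsometryEquiv.norm_map, norm_sub_rev]

theorem continuous_interactionField {U : ℝ → H ≃ₗᵢ[ℂ] H} (hU : IsContinuousGroup U) {B : H → H}
    (hB : Continuous B) : Continuous fun p : ℝ × H => interactionField U B p.1 p.2 := by
  have h := hU.continuous_uncurry
  exact ((h.comp (continuous_fst.neg.prodMk (hB.comp h))).const_smul Complex.I).neg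

/-- The group law splits the propagator from `s` to `t` into `U (φ t)` and `U (-φ s)`. The first
factor comes out of the integral and is cancelled by `U (-φ t)`. -/
theorem isSplitSolution_iff [CompleteSpace H] {A : H →ₗ.[ℂ] H} {B : H → H} {a b : ℝ → ℝ} {u₀ : H}
    {T : ℝ} {u : ℝ → H} (ha : ∀ s t, IntervalIntegrable a volume s t) :
    IsSplitSolution A B a b u₀ T u ↔ ContinuousOn u (Icc 0 T) ∧ ∀ t ∈ Icc 0 T,
      unitaryGroup A (-∫ r in (0 : ℝ)..t, a r) (u t) = u₀ + ∫ s in (0 : ℝ)..t,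
        b s • interactionField (unitaryGroup A) B (∫ r in (0 : ℝ)..s, a r)
          (unitaryGroup A (-∫ r in (0 : ℝ)..s, a r) (u s)) := by
  have hU := isContinuousGroup_unitaryGroup A
  refine and_congr_right fun _ => forall₂_congr fun t _ => ?_
  set φ : ℝ → ℝ := fun t => ∫ r in (0 : ℝ)..t, a r with hφ
  have hprop : ∀ s x, propagator A a t s x = unitaryGroup A (φ t) (unitaryGroup A (-φ s) x) := by
    intro s x
    rw [propagator, ← hU.map_add, hφ, ← sub_eq_add_neg,
      intervalIntegral.integral_interval_sub_left (ha _ _) (ha _ _)]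
  have h₁ : ∫ s in (0 : ℝ)..t, b s • propagator A a t s (B (u s)) =
      unitaryGroup A (φ t) (∫ s in (0 : ℝ)..t, b s • unitaryGroup A (-φ s) (B (u s))) := by
    rw [← LinearIsometryEquiv.coe_toLinearIsometry,
      ← LinearIsometry.intervalIntegral_comp_comm]
    congr 1
    funext s
    rw [hprop, LinearIsometryEquiv.coe_toLinearIsometry, map_real_smul (unitaryGroup A (φ t))
      (unitaryGroup A (φ t)).continuous]
  have h₂ : ∫ s in (0 : ℝ)..t, b s • interactionField (unitaryGroup A) B (φ s)
      (unitaryGroup A (-φ s) (u s)) =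
      -(Complex.I • ∫ s in (0 : ℝ)..t, b s • unitaryGroup A (-φ s) (B (u s))) := by
    rw [← intervalIntegral.integral_smul, ← intervalIntegral.integral_neg]
    congr 1
    funext s
    rw [interactionField, hU.apply_neg_apply, smul_neg, smul_comm]
  have h₃ : propagator A a t 0 u₀ = unitaryGroup A (φ t) u₀ := by
    rw [hprop, hφ]
    simp [hU.map_zero]
  change _ ↔ unitaryGroup A (-φ t) (u t) = u₀ + ∫ s in (0 : ℝ)..t,
    b s • interactionField (unitaryGroup A) B (φ s) (unitaryGroup A (-φ s) (u s))
  rw [h₁, h₂, h₃, ← map_smul, ← map_sub, ← sub_eq_add_neg]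
  constructor
  · intro h
    rw [h, hU.neg_apply_apply]
  · intro h
    rw [← h, hU.apply_neg_apply]

theorem isMildSolution_iff {A : H →ₗ.[ℂ] H} {B : H → H} {u₀ : H} {T : ℝ} {u : ℝ → H} :
    IsMildSolution A B u₀ T u ↔ IsSplitSolution A B (fun _ => 1) (fun _ => 1) u₀ T u := by
  simp [IsMildSolution, IsSplitSolution, propagator]

theorem exactFlow_eq_splitFlow (A : H →ₗ.[ℂ] H) (B : H → H) (t : ℝ) (u₀ : H) :
    exactFlow A B t u₀ = splitFlow A B (fun _ => 1) (fun _ => 1) t u₀ := by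
  have h : IsMildSolution A B u₀ t = IsSplitSolution A B (fun _ => 1) (fun _ => 1) u₀ t :=
    funext fun _ => propext isMildSolution_iff
  unfold exactFlow splitFlow
  rw [h]

namespace IsSplitSolution

variable {A : H →ₗ.[ℂ] H} {B : H → H} {a b : ℝ → ℝ} {u₀ : H} {S T : ℝ} {u w : ℝ → H}

theorem mono (h : IsSplitSolution A B a b u₀ T u) (hST : S ≤ T) :
    IsSplitSolution A B a b u₀ S u :=
  ⟨h.1.mono (Icc_subset_Icc_right hST), fun t ht => h.2 t (Icc_subset_Icc_right hST ht)⟩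

theorem congr (h : IsSplitSolution A B a b u₀ T u) (huw : EqOn w u (Icc 0 T)) :
    IsSplitSolution A B a b u₀ T w := by
  refine ⟨h.1.congr huw, fun t ht => ?_⟩
  rw [huw ht, h.2 t ht]
  congr 2
  refine intervalIntegral.integral_congr fun s hs => ?_
  rw [uIcc_of_le ht.1] at hs
  simp only [huw ⟨hs.1, hs.2.trans ht.2⟩]

/-- Constant extension beyond the endpoints makes integrands continuous on the whole line. -/
theorem exists_continuous (h : IsSplitSolution A B a b u₀ T u) (hT : 0 ≤ T) :
    ∃ w : ℝ → H, Continuous w ∧ EqOn w u (Icc 0 T) ∧ IsSplitSolution A B a b u₀ T w := by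
  have heq : EqOn (IccExtend hT ((Icc 0 T).domRestrict u)) u (Icc 0 T) := fun t ht => by
    rw [IccExtend_of_mem hT _ ht, domRestrict_apply]
  exact ⟨_, (continuousOn_iff_continuous_domRestrict.1 h.1).Icc_extend', heq, h.congr heq⟩

/-- `B` has a single Lipschitz constant on the compact union of the two trajectories, and Grönwall
with initial error `0` applies. -/
theorem eqOn_of_continuous [CompleteSpace H] {M : ℝ} (hB : LocallyLipschitz B)
    (ha : ∀ s t, IntervalIntegrable a volume s t) (hb : ∀ s t, IntervalIntegrable b volume s t)
    (hM : ∀ᵐ t ∂(volume : Measure ℝ), |b t| ≤ M)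
    (hu : IsSplitSolution A B a b u₀ T u) (hw : IsSplitSolution A B a b u₀ T w)
    (huc : Continuous u) (hwc : Continuous w) : EqOn u w (Icc 0 T) := by
  have hU := isContinuousGroup_unitaryGroup A
  have hM₀ : 0 ≤ M := by
    obtain ⟨x, hx⟩ := hM.exists
    exact (abs_nonneg _).trans hx
  obtain ⟨L, hL⟩ := (hB.locallyLipschitzOn (s := u '' Icc 0 T ∪ w '' Icc 0 T)
    ).exists_lipschitzOnWith_of_compact ((isCompact_Icc.image huc).union (isCompact_Icc.image hwc))
  have hu' := ((isSplitSolution_iff ha).1 hu).2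
  have hw' := ((isSplitSolution_iff ha).1 hw).2
  set φ : ℝ → ℝ := fun t => ∫ r in (0 : ℝ)..t, a r with hφ
  have hφc : Continuous φ := intervalIntegral.continuous_primitive ha 0
  have hint : ∀ x : ℝ → H, Continuous x → ∀ s t, IntervalIntegrable (fun s => b s •
      interactionField (unitaryGroup A) B (φ s) (unitaryGroup A (-φ s) (x s))) volume s t :=
    fun x hx s t => (hb s t).smul_continuousOn
      ((continuous_interactionField hU hB.continuous).comp (hφc.prodMk
        (hU.continuous_uncurry.comp (hφc.neg.prodMk hx)))).continuousOn
  have hgr := le_mul_exp_of_le_add_integral (f := fun t => ‖u t - w t‖) (a := 0) (K := M * L)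
    (T := T) (by positivity) (huc.sub hwc).norm fun t ht => by
      have h₁ : ‖u t - w t‖ = ‖unitaryGroup A (-φ t) (u t) - unitaryGroup A (-φ t) (w t)‖ := by
        rw [← map_sub, LinearIsometryEquiv.norm_map]
      rw [h₁, hu' t ht, hw' t ht, add_sub_add_left_eq_sub,
        ← intervalIntegral.integral_sub (hint u huc _ _) (hint w hwc _ _), zero_add,
        ← intervalIntegral.integral_const_mul]
      refine intervalIntegral.norm_integral_le_of_norm_le ht.1 ?_
        ((continuous_const.mul (huc.sub hwc).norm).intervalIntegrable _ _)
      filter_upwards [hM] with s hs hst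
      have hsT : s ∈ Icc 0 T := ⟨hst.1.le, hst.2.trans ht.2⟩
      rw [← smul_sub, norm_smul, norm_interactionField_sub, hU.apply_neg_apply,
        hU.apply_neg_apply, Real.norm_eq_abs, mul_assoc]
      exact mul_le_mul hs (hL.norm_sub_le (Or.inl (mem_image_of_mem _ hsT))
        (Or.inr (mem_image_of_mem _ hsT))) (norm_nonneg _) hM₀
  intro t ht
  have := hgr t ht
  rw [zero_mul] at this
  exact sub_eq_zero.1 (norm_le_zero_iff.1 this)

/-- The flow is defined through an arbitrarily chosen solution; uniqueness makes the choice
irrelevant. -/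
theorem splitFlow_eq [CompleteSpace H] {M t : ℝ} (hB : LocallyLipschitz B)
    (ha : ∀ s t, IntervalIntegrable a volume s t) (hb : ∀ s t, IntervalIntegrable b volume s t)
    (hM : ∀ᵐ t ∂(volume : Measure ℝ), |b t| ≤ M)
    (hu : IsSplitSolution A B a b u₀ T u) (ht : t ∈ Icc 0 T) :
    splitFlow A B a b t u₀ = u t := by
  have h : ∃ u : ℝ → H, IsSplitSolution A B a b u₀ t u := ⟨u, hu.mono ht.2⟩
  rw [splitFlow, dif_pos h]
  obtain ⟨u', huc, hue, hus⟩ := (hu.mono ht.2).exists_continuous ht.1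
  obtain ⟨w', hwc, hwe, hws⟩ := h.choose_spec.exists_continuous ht.1
  have htt : t ∈ Icc 0 t := ⟨ht.1, le_rfl⟩
  rw [← hue htt, ← hwe htt, eqOn_of_continuous hB ha hb hM hws hus hwc huc htt]

end IsSplitSolution

end Interaction

/-! ### Periodic coefficients of mean one. -/

section Coefficients

namespace IsSplittingCoefficient

variable {T h : ℝ} {α : ℝ → ℝ}

theorem intervalIntegrable (hα : IsSplittingCoefficient T α) (s t : ℝ) :
    IntervalIntegrable α volume s t :=
  (hα.locallyIntegrable.integrableOn_isCompact isCompact_uIcc).intervalIntegrable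

theorem integral_eq (hα : IsSplittingCoefficient T α) : ∫ t in (0 : ℝ)..T, α t = T := by
  -- For `T = 0` the quotient in `mean` would be `0` by the convention on division, not `1`.
  have hT : T ≠ 0 := by
    rintro rfl
    simpa using hα.mean
  exact (div_eq_one_iff_eq hT).1 hα.mean

theorem integral_nat_mul (hα : IsSplittingCoefficient T α) (k : ℕ) :
    ∫ t in (0 : ℝ)..(k * T), α t = k * T := by
  have := hα.periodic.intervalIntegral_add_zsmul_eq k 0 hα.intervalIntegrable
  simpa [hα.integral_eq] using this

theorem ae_abs_comp_mul_le {M c : ℝ} (hM : ∀ᵐ t ∂(volume : Measure ℝ), |α t| ≤ M) (hc : c ≠ 0) :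
    ∀ᵐ t ∂(volume : Measure ℝ), |α (c * t)| ≤ M := by
  have hq : Measure.QuasiMeasurePreserving (fun t : ℝ => c * t) volume volume := by
    refine ⟨measurable_const_mul c, ?_⟩
    rw [Real.map_volume_mul_left hc]
    exact Measure.smul_absolutelyContinuous
  exact hq.ae hM

theorem comp_nat_mul (hα : IsSplittingCoefficient T α) {n : ℕ} (hn : n ≠ 0) :
    IsSplittingCoefficient (T / n) fun t => α (n * t) := by
  have hn' : (n : ℝ) ≠ 0 := Nat.cast_ne_zero.2 hn
  obtain ⟨M, hM⟩ := hα.bounded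
  refine ⟨?_, ⟨M, ae_abs_comp_mul_le hM hn'⟩, fun t => ?_, ?_⟩
  · intro x
    refine ⟨Ioc (x - 1) (x + 1), Ioc_mem_nhds (by linarith) (by linarith), ?_⟩
    rw [← intervalIntegrable_iff_integrableOn_Ioc_of_le (by linarith)]
    have := (hα.intervalIntegrable (n * (x - 1)) (n * (x + 1))).comp_mul_left (c := (n : ℝ))
    simpa [mul_div_cancel_left₀ _ hn'] using this
  · rw [mul_add, mul_div_cancel₀ _ hn']
    exact hα.periodic _
  · rw [intervalIntegral.integral_comp_mul_left _ hn', mul_zero, mul_div_cancel₀ _ hn',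
      hα.integral_eq, smul_eq_mul, inv_mul_eq_div, div_self]
    have hT : T ≠ 0 := by
      rintro rfl
      simpa using hα.mean
    exact div_ne_zero hT hn'

theorem norm_integral_sub_one_smul_le {E : Type*} [NormedAddCommGroup E] [NormedSpace ℝ E]
    [CompleteSpace E] {M ω g : ℝ} {b : ℝ → ℝ} {G : ℝ → E} (hh : 0 < h)
    (hb : IsSplittingCoefficient h b) (hM : ∀ᵐ t ∂(volume : Measure ℝ), |b t| ≤ M)
    (hG : Continuous G) (hω : 0 ≤ ω) (hg : ∀ s ∈ Icc 0 T, ‖G s‖ ≤ g)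
    (hosc : ∀ s ∈ Icc 0 T, ∀ t ∈ Icc 0 T, |s - t| ≤ h → ‖G s - G t‖ ≤ ω) :
    ∀ t ∈ Icc 0 T, ‖∫ s in (0 : ℝ)..t, (b s - 1) • G s‖ ≤ (M + 1) * (ω * t + g * h) := by
  refine norm_integral_periodic_smul_le hh
    (fun s t => (hb.intervalIntegrable s t).sub intervalIntegrable_const)
    (fun t => by rw [hb.periodic]) ?_ ?_ hG hω hg hosc
  · rw [intervalIntegral.integral_sub (hb.intervalIntegrable _ _) intervalIntegrable_const,
      hb.integral_eq]
    simp
  · filter_upwards [hM] with t ht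
    exact (abs_sub _ _).trans (by simpa using ht)

/-- Averaging against the constant function `1`, which has no oscillation. -/
theorem abs_integral_sub_le {M : ℝ} {a : ℝ → ℝ} (hh : 0 < h)
    (ha : IsSplittingCoefficient h a) (hM : ∀ᵐ t ∂(volume : Measure ℝ), |a t| ≤ M) {t : ℝ}
    (ht : 0 ≤ t) : |(∫ s in (0 : ℝ)..t, a s) - t| ≤ (M + 1) * h := by
  have := norm_integral_sub_one_smul_le (T := t) (G := fun _ => (1 : ℝ)) (ω := 0) (g := 1) hh ha hM
    continuous_const le_rfl (by simp) (by simp) t ⟨ht, le_rfl⟩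
  simp only [smul_eq_mul, mul_one, zero_mul, zero_add, one_mul] at this
  rw [intervalIntegral.integral_sub (ha.intervalIntegrable _ _) intervalIntegrable_const] at this
  simpa using this

/-- The error made by replacing, in the time integral of a function `G(s, s)`, the first argument
by a perturbed time `φ` and the measure `ds` by the rapidly oscillating `b(s) ds`. -/
theorem norm_integral_smul_sub_integral_le {E : Type*} [NormedAddCommGroup E] [NormedSpace ℝ E]
    [CompleteSpace E] {M ω g κ : ℝ} {b φ : ℝ → ℝ} {S : Set ℝ} {G : ℝ → ℝ → E} (hh : 0 < h)
    (hhκ : h ≤ κ) (hb : IsSplittingCoefficient h b)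
    (hM : ∀ᵐ t ∂(volume : Measure ℝ), |b t| ≤ M) (hφ : Continuous φ)
    (hG : Continuous fun p : ℝ × ℝ => G p.1 p.2) (hω : 0 ≤ ω)
    (hS : ∀ s ∈ Icc 0 T, s ∈ S) (hφS : ∀ s ∈ Icc 0 T, φ s ∈ S)
    (hφκ : ∀ s ∈ Icc 0 T, |φ s - s| ≤ κ) (hg : ∀ τ ∈ S, ∀ s ∈ Icc 0 T, ‖G τ s‖ ≤ g)
    (hosc : ∀ τ ∈ S, ∀ τ' ∈ S, ∀ s ∈ Icc 0 T, ∀ s' ∈ Icc 0 T, |τ - τ'| ≤ κ → |s - s'| ≤ κ →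
      ‖G τ s - G τ' s'‖ ≤ ω) :
    ∀ t ∈ Icc 0 T, ‖(∫ s in (0 : ℝ)..t, b s • G (φ s) s) - ∫ s in (0 : ℝ)..t, G s s‖ ≤
      M * ω * t + (M + 1) * (ω * t + g * h) := by
  intro t ht
  have hG₁ : Continuous fun s => G (φ s) s := hG.comp (hφ.prodMk continuous_id)
  have hG₂ : Continuous fun s => G s s := hG.comp (continuous_id.prodMk continuous_id)
  have hi₁ := (hb.intervalIntegrable 0 t).smul_continuousOn hG₁.continuousOn
  have hi₂ := (hb.intervalIntegrable 0 t).smul_continuousOn hG₂.continuousOn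
  have hi₃ := hG₂.intervalIntegrable (μ := volume) 0 t
  have hsplit : (∫ s in (0 : ℝ)..t, b s • G (φ s) s) - ∫ s in (0 : ℝ)..t, G s s =
      (∫ s in (0 : ℝ)..t, b s • (G (φ s) s - G s s)) +
        ∫ s in (0 : ℝ)..t, (b s - 1) • G s s := by
    simp_rw [smul_sub, sub_smul, one_smul]
    rw [intervalIntegral.integral_sub hi₁ hi₂, intervalIntegral.integral_sub hi₂ hi₃,
      sub_add_sub_cancel]
  rw [hsplit]
  have hκ : 0 ≤ κ := hh.le.trans hhκ
  refine (norm_add_le _ _).trans (add_le_add ?_ ?_)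
  · have := norm_integral_smul_le (G := fun s => G (φ s) s - G s s) (g := ω) ht.1 hM fun s hs => by
      have hsT : s ∈ Icc 0 T := ⟨hs.1, hs.2.trans ht.2⟩
      exact hosc _ (hφS s hsT) _ (hS s hsT) s hsT s hsT (hφκ s hsT) (by simpa using hκ)
    simpa using this
  · exact norm_integral_sub_one_smul_le hh hb hM hG₂ hω (fun s hs => hg s (hS s hs) s hs)
      (fun s hs s' hs' hss => hosc s (hS s hs) s' (hS s' hs') s hs s' hs' (hss.trans hhκ)
        (hss.trans hhκ)) t ht

end IsSplittingCoefficient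

end Coefficients

/-! ### Defect and error estimates. -/

section Convergence

variable {H₁ H₀ : Type*} [NormedAddCommGroup H₁] [InnerProductSpace ℂ H₁]
    [NormedAddCommGroup H₀] [InnerProductSpace ℂ H₀]

/-- The derivative condition is needed only with `ε = 1`. Closeness is required in `H₁`, while the
Lipschitz bound is in `H₀`. -/
theorem HasUniformDerivative.exists_lipschitz {J : H₁ →L[ℂ] H₀} {B : H₁ → H₁}
    {B' : H₁ → H₀ →L[ℝ] H₀} (h : HasUniformDerivative J B B') {R : ℝ} (hR : 0 < R) :
    ∃ Λ > (0 : ℝ), ∃ δ > (0 : ℝ), ∀ x y : H₁, ‖x‖ ≤ R → ‖y - x‖ < δ →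
      ‖J (B y) - J (B x)‖ ≤ Λ * ‖J (y - x)‖ := by
  obtain ⟨C, hC, δ, hδ, hCδ⟩ := h R hR 1 one_pos
  refine ⟨C + 1, by positivity, δ, hδ, fun x y hx hxy => ?_⟩
  obtain ⟨h₁, h₂⟩ := hCδ x (y - x) hx hxy
  rw [add_sub_cancel] at h₂
  calc ‖J (B y) - J (B x)‖ = ‖(J (B y) - J (B x) - B' x (J (y - x))) + B' x (J (y - x))‖ := by
        rw [sub_add_cancel]
    _ ≤ 1 * ‖J (y - x)‖ + C * ‖J (y - x)‖ :=
        (norm_add_le _ _).trans (add_le_add h₂ ((B' x).le_of_opNorm_le h₁ _))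
    _ = (C + 1) * ‖J (y - x)‖ := by ring

theorem norm_map_interactionField_sub {J : H₁ →L[ℂ] H₀} {U : ℝ → H₁ ≃ₗᵢ[ℂ] H₁} {K : ℝ}
    (hJ : IsRegularEmbedding J U K) (B : H₁ → H₁) (τ : ℝ) (x y : H₁) :
    ‖J (interactionField U B τ x) - J (interactionField U B τ y)‖ =
      ‖J (B (U τ x)) - J (B (U τ y))‖ := by
  rw [← map_sub, interactionField, interactionField, neg_sub_neg, ← smul_sub, ← map_sub, map_smul,
    norm_smul, Complex.norm_I, one_mul, hJ.norm_map, map_sub, norm_sub_rev]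

/-- Along a Lipschitz curve the interaction field is locally Lipschitz in time in the norm of
`H₀`. -/
theorem exists_lipschitz_map_interactionField {J : H₁ →L[ℂ] H₀} {U : ℝ → H₁ ≃ₗᵢ[ℂ] H₁} {K : ℝ}
    (hU : IsContinuousGroup U) (hJ : IsRegularEmbedding J U K) {B : H₁ → H₁}
    {B' : H₁ → H₀ →L[ℝ] H₀} (hB : HasUniformDerivative J B B') {v : ℝ → H₁} (hv : Continuous v)
    {I S : Set ℝ} (hI : IsCompact I) (hS : IsCompact S) {ℓ g : ℝ} (hℓ : 0 ≤ ℓ) (hg : 0 ≤ g)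
    (hvlip : ∀ s ∈ I, ∀ s' ∈ I, ‖v s - v s'‖ ≤ ℓ * |s - s'|)
    (hbound : ∀ τ ∈ S, ∀ s ∈ I, ‖interactionField U B τ (v s)‖ ≤ g) :
    ∃ Λ : ℝ, 0 ≤ Λ ∧ ∃ ρ > (0 : ℝ), ∀ τ ∈ S, ∀ τ' ∈ S, ∀ s ∈ I, ∀ s' ∈ I,
      |τ - τ'| < ρ → |s - s'| < ρ →
      ‖J (interactionField U B τ (v s)) - J (interactionField U B τ' (v s'))‖ ≤
        Λ * (|τ - τ'| + |s - s'|) := by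
  obtain ⟨R₀, hR₀⟩ := hI.exists_bound_of_continuousOn hv.continuousOn
  set R := max R₀ 1 with hRdef
  have hR : 0 < R := lt_max_of_lt_right one_pos
  have hvR : ∀ s ∈ I, ‖v s‖ ≤ R := fun s hs => (hR₀ s hs).trans (le_max_left _ _)
  obtain ⟨Λ, hΛ, δ, hδ, hlip⟩ := hB.exists_lipschitz hR
  have hc : Continuous fun p : ℝ × ℝ => U p.1 (v p.2) :=
    hU.continuous_uncurry.comp (continuous_fst.prodMk (hv.comp continuous_snd))
  obtain ⟨ρ, hρ, huc⟩ := Metric.uniformContinuousOn_iff.1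
    ((hS.prod hI).uniformContinuousOn_of_continuous hc.continuousOn) δ hδ
  have hK := hJ.nonneg
  refine ⟨K * g + Λ * (K * R) + Λ * (‖J‖ * ℓ), by positivity, ρ, hρ,
    fun τ hτ τ' hτ' s hs s' hs' hττ hss => ?_⟩
  have hclose : ∀ σ ∈ S, ∀ σ' ∈ S, ∀ r ∈ I, ∀ r' ∈ I, |σ - σ'| < ρ → |r - r'| < ρ →
      ‖U σ (v r) - U σ' (v r')‖ < δ := fun σ hσ σ' hσ' r hr r' hr' h₁ h₂ => by
    rw [← dist_eq_norm]
    exact huc (σ, r) ⟨hσ, hr⟩ (σ', r') ⟨hσ', hr'⟩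
      (max_lt (by rwa [Real.dist_eq]) (by rwa [Real.dist_eq]))
  have hUR : ∀ σ, ∀ r ∈ I, ‖U σ (v r)‖ ≤ R := fun σ r hr => by
    rw [LinearIsometryEquiv.norm_map]
    exact hvR r hr
  -- Three changes are made one at a time: the outer group (`h₁`), the inner group (`h₂`) and the
  -- point on the curve (`h₃`). The last two use the `H₀` Lipschitz bound for `B`, whose `H₁`
  -- closeness condition comes from uniform continuity on the compact set `S ×ˢ I`.
  have h₁ : ‖J (U (-τ) (B (U τ (v s)))) - J (U (-τ') (B (U τ (v s))))‖ ≤ K * |τ - τ'| * g := by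
    refine (hJ.lipschitz (-τ') (-τ) _).trans ?_
    rw [neg_sub_neg, abs_sub_comm τ' τ, ← norm_interactionField]
    exact mul_le_mul_of_nonneg_left (hbound τ hτ s hs) (by positivity)
  have h₂ : ‖J (U (-τ') (B (U τ (v s)))) - J (U (-τ') (B (U τ' (v s))))‖ ≤
      Λ * (K * |τ - τ'| * R) := by
    rw [← map_sub, ← map_sub, hJ.norm_map, map_sub]
    refine (hlip _ _ (hUR _ s hs)
      (hclose τ hτ τ' hτ' s hs s hs hττ (by simpa using hρ))).trans ?_
    refine mul_le_mul_of_nonneg_left ?_ hΛ.le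
    rw [map_sub]
    exact (hJ.lipschitz τ' τ _).trans
      (mul_le_mul_of_nonneg_left (hvR s hs) (by positivity))
  have h₃ : ‖J (interactionField U B τ' (v s)) - J (interactionField U B τ' (v s'))‖ ≤
      Λ * (‖J‖ * (ℓ * |s - s'|)) := by
    rw [norm_map_interactionField_sub hJ]
    refine (hlip _ _ (hUR _ s' hs')
      (hclose τ' hτ' τ' hτ' s hs s' hs' (by simpa using hρ) hss)).trans ?_
    refine mul_le_mul_of_nonneg_left ?_ hΛ.le
    rw [← map_sub, hJ.norm_map]
    exact (J.le_opNorm _).trans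
      (mul_le_mul_of_nonneg_left (hvlip s hs s' hs') (norm_nonneg _))
  have h₄ : ‖J (interactionField U B τ (v s)) - J (interactionField U B τ' (v s))‖ ≤
      K * |τ - τ'| * g + Λ * (K * |τ - τ'| * R) := by
    rw [← map_sub, interactionField, interactionField, neg_sub_neg, ← smul_sub, map_smul,
      norm_smul, Complex.norm_I, one_mul, map_sub, norm_sub_rev]
    exact (norm_sub_le_norm_sub_add_norm_sub _ _ _).trans (add_le_add h₁ h₂)
  refine ((norm_sub_le_norm_sub_add_norm_sub _ _ _).trans (add_le_add h₄ h₃)).trans ?_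
  have e₁ : 0 ≤ (K * g + Λ * (K * R)) * |s - s'| := by positivity
  have e₂ : 0 ≤ Λ * (‖J‖ * ℓ) * |τ - τ'| := by positivity
  linarith

/-- Global error estimate in the interaction picture, for all coefficients with a common bound `M`
and a common small period `h`. -/
theorem eventually_exists_solution_and_error_le [CompleteSpace H₁] [CompleteSpace H₀]
    {J : H₁ →L[ℂ] H₀} {U : ℝ → H₁ ≃ₗᵢ[ℂ] H₁} {K : ℝ}
    (hU : IsContinuousGroup U) (hJ : IsRegularEmbedding J U K) {B : H₁ → H₁}
    (hB : LocallyLipschitz B) {B' : H₁ → H₀ →L[ℝ] H₀} (hB' : HasUniformDerivative J B B')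
    {u₀ : H₁} {T M : ℝ} (hT : 0 ≤ T) (hM : 0 ≤ M) {v : ℝ → H₁} (hv : Continuous v)
    (hsol : ∀ t ∈ Icc 0 T, v t = u₀ + ∫ s in (0 : ℝ)..t, interactionField U B s (v s)) :
    ∃ C > (0 : ℝ), ∀ᶠ h in nhdsWithin (0 : ℝ) (Ioi 0), ∀ a b : ℝ → ℝ,
      IsSplittingCoefficient h a → IsSplittingCoefficient h b →
      (∀ᵐ t ∂(volume : Measure ℝ), |a t| ≤ M) → (∀ᵐ t ∂(volume : Measure ℝ), |b t| ≤ M) →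
      ∃ w : ℝ → H₁, Continuous w ∧
        (∀ t ∈ Icc 0 T, w t = u₀ + ∫ s in (0 : ℝ)..t,
          b s • interactionField U B (∫ r in (0 : ℝ)..s, a r) (w s)) ∧
        ∀ t ∈ Icc 0 T, ‖J (w t) - J (v t)‖ ≤ C * h := by
  have hF := continuous_interactionField hU hB.continuous
  -- The margin `1` leaves room for the perturbed times `φ s`, which are within `(M + 1) * h < 1` of
  -- `s`.
  set S : Set ℝ := Icc (-1) (T + 1) with hSdef
  have hS : IsCompact S := isCompact_Icc
  have hTS : ∀ s ∈ Icc 0 T, s ∈ S := fun s hs => ⟨by linarith [hs.1], by linarith [hs.2]⟩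
  set G : ℝ → ℝ → H₁ := fun τ s => interactionField U B τ (v s) with hGdef
  have hG : Continuous fun p : ℝ × ℝ => G p.1 p.2 :=
    hF.comp (continuous_fst.prodMk (hv.comp continuous_snd))
  have hGd : Continuous fun s => G s s := hG.comp (continuous_id.prodMk continuous_id)
  have hSI : IsCompact (S ×ˢ Icc 0 T) := hS.prod isCompact_Icc
  obtain ⟨g, hg⟩ := hSI.exists_bound_of_continuousOn hG.continuousOn
  have hg' : ∀ τ ∈ S, ∀ s ∈ Icc 0 T, ‖G τ s‖ ≤ g := fun τ hτ s hs => hg (τ, s) ⟨hτ, hs⟩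
  have h0T : (0 : ℝ) ∈ Icc 0 T := ⟨le_rfl, hT⟩
  have hg₀ : 0 ≤ g := (norm_nonneg _).trans (hg' 0 (hTS 0 h0T) 0 h0T)
  have hvlip : ∀ s ∈ Icc 0 T, ∀ s' ∈ Icc 0 T, ‖v s - v s'‖ ≤ g * |s - s'| := by
    intro s hs s' hs'
    rw [hsol s hs, hsol s' hs', add_sub_add_left_eq_sub,
      intervalIntegral.integral_interval_sub_left (hGd.intervalIntegrable _ _)
        (hGd.intervalIntegrable _ _)]
    refine intervalIntegral.norm_integral_le_of_norm_le_const fun r hr => ?_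
    have hr' : r ∈ Icc 0 T := uIcc_subset_Icc hs' hs (uIoc_subset_uIcc hr)
    exact hg' r (hTS r hr') r hr'
  obtain ⟨Λ, hΛ, ρ, hρ, hGlip⟩ := exists_lipschitz_map_interactionField hU hJ hB' hv
    isCompact_Icc hS hg₀ hg₀ hvlip hg'
  -- Lipschitz constants of `B` near the reference solution, in both norms
  have hUv : Continuous fun p : ℝ × ℝ => U p.1 (v p.2) :=
    hU.continuous_uncurry.comp (continuous_fst.prodMk (hv.comp continuous_snd))
  obtain ⟨ε, hε, L, hL, htube⟩ := exists_uniform_lipschitz_of_isCompact hB (hSI.image hUv)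
  obtain ⟨R₀, hR₀⟩ := (isCompact_Icc (a := (0 : ℝ)) (b := T)).exists_bound_of_continuousOn
    hv.continuousOn
  obtain ⟨Λ', hΛ', δ, hδ, hBlip⟩ := hB'.exists_lipschitz (lt_max_of_lt_right one_pos : 0 < max R₀ 1)
  -- the admissible defect
  set ε₁ : ℝ := min ε (δ / 2) with hε₁def
  have hε₁ : 0 < ε₁ := lt_min hε (half_pos hδ)
  set η : ℝ := ε₁ / (2 * Real.exp ((2 * M * L + 1) * T)) with hηdef
  have hη : 0 < η := by positivity
  have hη' : 2 * η * Real.exp ((2 * M * L + 1) * T) = ε₁ := by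
    rw [hηdef]
    have := (Real.exp_pos ((2 * M * L + 1) * T)).ne'
    field_simp
  -- The oscillation allowed in `H₁`: its contribution to the defect is at most `η / 2`, leaving `η
  -- / 2` for the incomplete period.
  set ω : ℝ := η / (2 * ((2 * M + 1) * T + 1)) with hωdef
  have hω : 0 < ω := by positivity
  have hωη : (2 * M + 1) * T * ω ≤ η / 2 := by
    have h₁ : ((2 * M + 1) * T + 1) * ω = η / 2 := by
      rw [hωdef]
      field_simp
    linarith
  obtain ⟨ρ', hρ', huc⟩ := Metric.uniformContinuousOn_iff.1
    (hSI.uniformContinuousOn_of_continuous hG.continuousOn) ω hω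
  set D : ℝ := (2 * M + 1) * T * (Λ * (2 * (M + 1))) + (M + 1) * (‖J‖ * g) with hD
  have hD₀ : 0 ≤ D := by positivity
  -- The summand `1` only makes the constant positive, as `D` may vanish.
  refine ⟨D * Real.exp (M * Λ' * T) + 1, by positivity, ?_⟩
  have hsmall : ∀ c x : ℝ, 0 < x → ∀ᶠ h in nhdsWithin (0 : ℝ) (Ioi 0), c * h < x := by
    intro c x hx
    have : Filter.Tendsto (fun h : ℝ => c * h) (nhdsWithin 0 (Ioi 0)) (nhds 0) := by
      have h₁ : Continuous fun h : ℝ => c * h := continuous_const.mul continuous_id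
      simpa using (h₁.tendsto 0).mono_left nhdsWithin_le_nhds
    exact this.eventually (gt_mem_nhds hx)
  filter_upwards [self_mem_nhdsWithin, hsmall (M + 1) 1 one_pos, hsmall (M + 1) ρ hρ,
    hsmall (M + 1) ρ' hρ', hsmall ((M + 1) * g) (η / 2) (half_pos hη)]
    with h hh hh₁ hhρ hhρ' hhη a b ha hb haM hbM
  replace hh : 0 < h := hh
  set κ : ℝ := (M + 1) * h with hκ
  have hhκ : h ≤ κ := by
    have := mul_nonneg hM hh.le
    linarith
  set φ : ℝ → ℝ := fun s => ∫ r in (0 : ℝ)..s, a r with hφdef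
  have hφ : Continuous φ := intervalIntegral.continuous_primitive ha.intervalIntegrable 0
  have hφκ : ∀ s ∈ Icc 0 T, |φ s - s| ≤ κ := fun s hs => ha.abs_integral_sub_le hh haM hs.1
  have hφS : ∀ s ∈ Icc 0 T, φ s ∈ S := fun s hs => by
    have := abs_le.1 ((hφκ s hs).trans hh₁.le)
    exact ⟨by linarith [hs.1], by linarith [hs.2]⟩
  -- Smallness without a rate, in `H₁`, from uniform continuity; `hdefect₀` below has the rate `h`,
  -- in `H₀`, from the Lipschitz bound `hGlip`.
  have hdefect : ∀ t ∈ Icc 0 T, ‖u₀ + (∫ s in (0 : ℝ)..t, b s • G (φ s) s) - v t‖ ≤ η := by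
    intro t ht
    rw [hsol t ht, add_sub_add_left_eq_sub]
    refine (hb.norm_integral_smul_sub_integral_le hh hhκ hbM hφ hG hω.le hTS hφS hφκ hg'
      (fun τ hτ τ' hτ' s hs s' hs' h₁ h₂ => ?_) t ht).trans ?_
    · rw [← dist_eq_norm]
      exact (huc (τ, s) ⟨hτ, hs⟩ (τ', s') ⟨hτ', hs'⟩ (max_lt
        (by rw [Real.dist_eq]; exact h₁.trans_lt hhρ')
        (by rw [Real.dist_eq]; exact h₂.trans_lt hhρ'))).le
    · calc M * ω * t + (M + 1) * (ω * t + g * h) = (2 * M + 1) * t * ω + (M + 1) * g * h := by ring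
        _ ≤ (2 * M + 1) * T * ω + (M + 1) * g * h := by
            gcongr
            exact ht.2
        _ ≤ η := by linarith
  have hdefect₀ : ∀ t ∈ Icc 0 T,
      ‖(∫ s in (0 : ℝ)..t, b s • J (G (φ s) s)) - ∫ s in (0 : ℝ)..t, J (G s s)‖ ≤ D * h := by
    intro t ht
    refine (hb.norm_integral_smul_sub_integral_le (G := fun τ s => J (G τ s)) (g := ‖J‖ * g)
      (ω := Λ * (2 * κ)) hh hhκ hbM hφ
      (J.continuous.comp hG) (by positivity) hTS hφS hφκ
      (fun τ hτ s hs => (J.le_opNorm _).trans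
        (mul_le_mul_of_nonneg_left (hg' τ hτ s hs) (norm_nonneg _)))
      (fun τ hτ τ' hτ' s hs s' hs' h₁ h₂ => ?_) t ht).trans ?_
    · refine (hGlip τ hτ τ' hτ' s hs s' hs' (h₁.trans_lt hhρ) (h₂.trans_lt hhρ)).trans
        (mul_le_mul_of_nonneg_left (by linarith) hΛ)
    · calc M * (Λ * (2 * κ)) * t + (M + 1) * (Λ * (2 * κ) * t + ‖J‖ * g * h) =
            (2 * M + 1) * t * (Λ * (2 * κ)) + (M + 1) * (‖J‖ * g) * h := by ring
        _ ≤ (2 * M + 1) * T * (Λ * (2 * κ)) + (M + 1) * (‖J‖ * g) * h := by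
            gcongr
            exact ht.2
        _ = D * h := by
            rw [hD, hκ]
            ring
  obtain ⟨w, hw, hwsol, hwv⟩ := exists_solution_near (T := T) (ε := ε) (L := L) (M := M) (η := η)
    hT hL hb.intervalIntegrable hbM (f := fun s x => interactionField U B (φ s) x)
    (hF.comp ((hφ.comp continuous_fst).prodMk continuous_snd)) hv u₀
    (fun s hs x hx y hy => by
      have hmem : ∀ z ∈ Metric.closedBall (v s) ε,
          U (φ s) z ∈ Metric.closedBall (U (φ s) (v s)) ε := fun z hz => by
        rwa [Metric.mem_closedBall, LinearIsometryEquiv.dist_map]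
      have := htube _ (mem_image_of_mem _ (⟨hφS s hs, hs⟩ : (φ s, s) ∈ S ×ˢ Icc 0 T)) _
        (hmem x hx) _ (hmem y hy)
      rwa [← map_sub, LinearIsometryEquiv.norm_map, ← norm_interactionField_sub] at this)
    hdefect (hη'.le.trans (min_le_left _ _))
  refine ⟨w, hw, hwsol, fun t ht => ?_⟩
  rw [hη'] at hwv
  have hwv' : ∀ s ∈ Icc 0 T, ‖w s - v s‖ < δ := fun s hs =>
    ((hwv s hs).trans (min_le_right _ _)).trans_lt (half_lt_self hδ)
  have hint : ∀ x : ℝ → H₁, Continuous x → ∀ s t, IntervalIntegrable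
      (fun s => b s • interactionField U B (φ s) (x s)) volume s t := fun x hx s t =>
    (hb.intervalIntegrable s t).smul_continuousOn (hF.comp (hφ.prodMk hx)).continuousOn
  have hmap : ∀ x : ℝ → H₁, Continuous x → ∀ t,
      J (∫ s in (0 : ℝ)..t, b s • interactionField U B (φ s) (x s)) =
        ∫ s in (0 : ℝ)..t, b s • J (interactionField U B (φ s) (x s)) := fun x hx t => by
    rw [← ContinuousLinearMap.intervalIntegral_comp_comm _ (hint x hx _ _)]
    congr 1
    funext s
    exact map_real_smul J J.continuous _ _
  have hintJ : ∀ x : ℝ → H₁, Continuous x → ∀ s t, IntervalIntegrable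
      (fun s => b s • J (interactionField U B (φ s) (x s))) volume s t := fun x hx s t =>
    (hb.intervalIntegrable s t).smul_continuousOn
      (J.continuous.comp (hF.comp (hφ.prodMk hx))).continuousOn
  have hdiff : Continuous fun s => ‖J (w s) - J (v s)‖ :=
    ((J.continuous.comp hw).sub (J.continuous.comp hv)).norm
  -- The error splits at the integral of `b s • J (G (φ s) s)`: the defect of `v` is bounded by `D *
  -- h`, and the rest compares `w` and `v` in the same field. The bound `hwv'` in `H₁` is what
  -- permits the Lipschitz estimate of `B` in `H₀`.
  have hgr := le_mul_exp_of_le_add_integral (f := fun s => ‖J (w s) - J (v s)‖) (a := D * h)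
    (K := M * Λ') (T := T) (by positivity) hdiff (fun t ht => by
      rw [hwsol t ht, hsol t ht, ← map_sub, add_sub_add_left_eq_sub, map_sub, hmap w hw,
        ← ContinuousLinearMap.intervalIntegral_comp_comm J (hGd.intervalIntegrable 0 t)]
      rw [← sub_add_sub_cancel _ (∫ s in (0 : ℝ)..t, b s • J (G (φ s) s)) _, add_comm (D * h)]
      refine (norm_add_le _ _).trans (add_le_add ?_ (hdefect₀ t ht))
      rw [← intervalIntegral.integral_sub (hintJ w hw _ _) (hintJ v hv _ _),
        ← intervalIntegral.integral_const_mul]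
      refine intervalIntegral.norm_integral_le_of_norm_le ht.1 ?_
        ((continuous_const.mul hdiff).intervalIntegrable _ _)
      filter_upwards [hbM] with s hs hst
      have hsT : s ∈ Icc 0 T := ⟨hst.1.le, hst.2.trans ht.2⟩
      rw [← smul_sub, norm_smul, norm_map_interactionField_sub hJ, Real.norm_eq_abs, mul_assoc]
      refine mul_le_mul hs ?_ (norm_nonneg _) hM
      have := hBlip (U (φ s) (v s)) (U (φ s) (w s))
        (by rw [LinearIsometryEquiv.norm_map]; exact (hR₀ s hsT).trans (le_max_left _ _))
        (by rw [← map_sub, LinearIsometryEquiv.norm_map]; exact hwv' s hsT)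
      rwa [← map_sub (U (φ s)), hJ.norm_map, map_sub J (w s)] at this) t ht
  refine hgr.trans ?_
  have hexp : Real.exp (M * Λ' * t) ≤ Real.exp (M * Λ' * T) :=
    Real.exp_le_exp.2 (mul_le_mul_of_nonneg_left ht.2 (by positivity))
  calc D * h * Real.exp (M * Λ' * t) ≤ D * h * Real.exp (M * Λ' * T) :=
        mul_le_mul_of_nonneg_left hexp (by positivity)
    _ ≤ (D * Real.exp (M * Λ' * T) + 1) * h := by linarith

theorem exists_isMildSolution_of_lt_maximalTime {A : H₁ →ₗ.[ℂ] H₁} {B : H₁ → H₁} {u₀ : H₁} {T : ℝ}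
    (h : ENNReal.ofReal T < maximalTime A B u₀) : ∃ u : ℝ → H₁, IsMildSolution A B u₀ T u := by
  obtain ⟨τ, ⟨T', _, rfl, u, hu⟩, hlt⟩ := lt_sSup_iff.1 h
  exact ⟨u, isMildSolution_iff.2
    ((isMildSolution_iff.1 hu).mono (ENNReal.ofReal_lt_ofReal_iff'.1 hlt).1.le)⟩

end Convergence

end AbstractSplitting

/-! ### Return to the original variables. -/

theorem theorem3p10 {H₁ H₀ : Type*}
    [NormedAddCommGroup H₁] [InnerProductSpace ℂ H₁] [CompleteSpace H₁]
    [NormedAddCommGroup H₀] [InnerProductSpace ℂ H₀] [CompleteSpace H₀]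
    (A : H₁ →ₗ.[ℂ] H₁) (hA : IsSelfAdjoint A)
    (B : H₁ → H₁) (hB : LocallyLipschitz B)
    (J : H₁ →L[ℂ] H₀) (hJ : Function.Injective J)
    (A₀ : H₀ →ₗ.[ℂ] H₀) (hA₀ : IsSelfAdjoint A₀)
    (hdom : ∀ x : H₁, J x ∈ A₀.domain)
    (hext : ∀ x : A.domain, A₀ ⟨J (x : H₁), hdom x⟩ = J (A x))
    (B' : H₁ → H₀ →L[ℝ] H₀) (hB' : AbstractSplitting.HasUniformDerivative J B B')
    (u₀ : H₁) (T : ℝ) (hT : 0 < T)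
    (hTmax : ENNReal.ofReal T < AbstractSplitting.maximalTime A B u₀)
    (α β : ℝ → ℝ) (hα : AbstractSplitting.IsSplittingCoefficient T α)
    (hβ : AbstractSplitting.IsSplittingCoefficient T β) :
    ∃ C > (0 : ℝ), ∃ n₀ : ℕ, ∀ n : ℕ, n₀ ≤ n →
      (∃ v : ℝ → H₁, AbstractSplitting.IsSplitSolution A B
        (fun t => α (n * t)) (fun t => β (n * t)) u₀ T v) ∧
      ∀ k : ℕ, k ≤ n →
        ‖J (AbstractSplitting.exactFlow A B (k * (T / n)) u₀) -
          J (AbstractSplitting.splitFlow A B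
            (fun t => α (n * t)) (fun t => β (n * t)) (k * (T / n)) u₀)‖ ≤ C * (T / n) := by

  have hU := AbstractSplitting.isContinuousGroup_unitaryGroup A
  obtain ⟨K, hK⟩ := AbstractSplitting.exists_isRegularEmbedding_unitaryGroup A hA J A₀ hA₀ hdom hext
  obtain ⟨u', hu'⟩ := AbstractSplitting.exists_isMildSolution_of_lt_maximalTime hTmax
  obtain ⟨u, huc, -, hu⟩ :=
    (AbstractSplitting.isMildSolution_iff.1 hu').exists_continuous hT.le
  obtain ⟨Mα, hMα⟩ := hα.bounded
  obtain ⟨Mβ, hMβ⟩ := hβ.bounded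
  set M : ℝ := max 0 (max Mα Mβ) with hM
  replace hMα : ∀ᵐ t ∂(volume : Measure ℝ), |α t| ≤ M :=
    hMα.mono fun t ht => ht.trans ((le_max_left _ _).trans (le_max_right _ _))
  replace hMβ : ∀ᵐ t ∂(volume : Measure ℝ), |β t| ≤ M :=
    hMβ.mono fun t ht => ht.trans ((le_max_right _ _).trans (le_max_right _ _))
  have hone : ∀ s t, IntervalIntegrable (fun _ : ℝ => (1 : ℝ)) volume s t := fun _ _ =>
    intervalIntegrable_const
  set U := AbstractSplitting.unitaryGroup A with hUdef
  have hv : Continuous fun t => U (-t) (u t) :=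
    hU.continuous_uncurry.comp (continuous_neg.prodMk huc)
  have hsol : ∀ t ∈ Icc 0 T, U (-t) (u t) = u₀ + ∫ s in (0 : ℝ)..t,
      AbstractSplitting.interactionField U B s (U (-s) (u s)) := by
    simpa using ((AbstractSplitting.isSplitSolution_iff hone).1 hu).2
  obtain ⟨C, hC, hev⟩ := AbstractSplitting.eventually_exists_solution_and_error_le hU hK hB hB' hT.le
    (le_max_left 0 (max Mα Mβ)) hv hsol
  have htend : Filter.Tendsto (fun n : ℕ => T / n) Filter.atTop (nhdsWithin 0 (Ioi 0)) :=
    tendsto_nhdsWithin_iff.2 ⟨tendsto_const_div_atTop_nhds_zero_nat T,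
      (Filter.eventually_gt_atTop 0).mono fun n hn => div_pos hT (Nat.cast_pos.2 hn)⟩
  -- The core estimate is uniform over all coefficients with period `h` and bound `M`, so one `C`
  -- serves the rescaled coefficients for every large `n`.
  obtain ⟨n₀, hn₀⟩ := Filter.eventually_atTop.1
    ((htend.eventually hev).and (Filter.eventually_gt_atTop 0))
  refine ⟨C, hC, n₀, fun n hn => ?_⟩
  obtain ⟨hcore, hnpos⟩ := hn₀ n hn
  have hn' : (n : ℝ) ≠ 0 := Nat.cast_ne_zero.2 hnpos.ne'
  have hαn := hα.comp_nat_mul hnpos.ne'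
  have hβn := hβ.comp_nat_mul hnpos.ne'
  have hMβn := AbstractSplitting.IsSplittingCoefficient.ae_abs_comp_mul_le hMβ hn'
  obtain ⟨w, hwc, hwsol, herr⟩ := hcore _ _ hαn hβn
    (AbstractSplitting.IsSplittingCoefficient.ae_abs_comp_mul_le hMα hn') hMβn
  set φ : ℝ → ℝ := fun t => ∫ r in (0 : ℝ)..t, α (n * r) with hφdef
  have hφ : Continuous φ := intervalIntegral.continuous_primitive hαn.intervalIntegrable 0
  have hsplit : AbstractSplitting.IsSplitSolution A B (fun t => α (n * t)) (fun t => β (n * t)) u₀ T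
      fun t => U (φ t) (w t) := by
    rw [AbstractSplitting.isSplitSolution_iff hαn.intervalIntegrable]
    refine ⟨(hU.continuous_uncurry.comp (hφ.prodMk hwc)).continuousOn, fun t ht => ?_⟩
    simp only [← hUdef]
    change U (-φ t) (U (φ t) (w t)) = u₀ + ∫ s in (0 : ℝ)..t, β (n * s) •
      AbstractSplitting.interactionField U B (φ s) (U (-φ s) (U (φ s) (w s)))
    simp only [hU.neg_apply_apply]
    exact hwsol t ht
  refine ⟨⟨_, hsplit⟩, fun k hk => ?_⟩
  have hkT : (k : ℝ) * (T / n) ∈ Icc 0 T := by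
    refine ⟨by positivity, ?_⟩
    rw [mul_div_assoc', div_le_iff₀ (Nat.cast_pos.2 hnpos), mul_comm]
    exact mul_le_mul_of_nonneg_left (Nat.cast_le.2 hk) hT.le
  rw [AbstractSplitting.exactFlow_eq_splitFlow,
    hu.splitFlow_eq hB hone hone (M := 1) (by simp) hkT,
    hsplit.splitFlow_eq hB hαn.intervalIntegrable hβn.intervalIntegrable hMβn hkT]
  -- At the end of a full period the accumulated time is exact, so `U` with one and the same
  -- argument acts on both interaction-picture solutions and drops out of the `H₀` norm.
  have hφk : φ (k * (T / n)) = k * (T / n) := hαn.integral_nat_mul k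
  have h₁ := herr _ hkT
  rw [← map_sub, ← hK.norm_map (k * (T / n)), map_sub, hU.apply_neg_apply, map_sub,
    norm_sub_rev] at h₁
  rw [hφk]
  exact h₁
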